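/- Let $G$ be a finite simple graph with at least five vertices. Suppose that $G$ is outerplanar, that is, $G$ can be drawn in the plane (vertices as distinct points, edges as simple curves joining their ends) so that no two edges intersect except at vertices and every vertex lies on the boundary of the outer (unbounded) face. Suppose further that $G$ is biconnected, that is, $G$ is connected and remains connected after the deletion of any single vertex. Then $G$ has no pair of alike vertices: there are no two distinct vertices $u \neq v$ of $G$ with the same set of neighbours. -/

import Mathlib

namespace SimpleGraph

/-- A drawing of a graph in the plane in which no two edges intersect except at the vertices:
the vertices are distinct points of the plane, each edge is drawn as a simple curve (an injective
continuous image of `[0, 1]`) joining its two ends, a curve meets vertices only at the ends of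
its edge, and the curves of two distinct edges meet only at vertices. -/
structure PlaneDrawing {V : Type*} (G : SimpleGraph V) where
  /-- The position of each vertex. -/
  point : V → EuclideanSpace ℝ (Fin 2)
  /-- The curve along which each edge is drawn. -/
  curve : G.edgeSet → unitInterval → EuclideanSpace ℝ (Fin 2)
  point_injective : Function.Injective point
  curve_continuous : ∀ e, Continuous (curve e)
  curve_injective : ∀ e, Function.Injective (curve e)
  /-- As an unordered pair, the ends of the curve of `e` are the positions of the ends of `e`. -/
  curve_ends : ∀ e : G.edgeSet, s(curve e 0, curve e 1) = Sym2.map point (e : Sym2 V)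
  mem_of_curve_eq_point : ∀ (e : G.edgeSet) (t : unitInterval) (v : V),
    curve e t = point v → v ∈ (e : Sym2 V)
  inter_subset : ∀ e f : G.edgeSet, e ≠ f →
    Set.range (curve e) ∩ Set.range (curve f) ⊆ Set.range point

namespace PlaneDrawing

variable {V : Type*} {G : SimpleGraph V}

/-- The set of all points of the plane covered by the drawing. -/
def support (D : G.PlaneDrawing) : Set (EuclideanSpace ℝ (Fin 2)) :=
  Set.range D.point ∪ ⋃ e, Set.range (D.curve e)

/-- The face of the drawing that contains `x` (for `x` off the drawing): the connected component
of `x` in the complement of the drawing. -/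
def face (D : G.PlaneDrawing) (x : EuclideanSpace ℝ (Fin 2)) :
    Set (EuclideanSpace ℝ (Fin 2)) :=
  connectedComponentIn D.supportᶜ x

/-- The outer face: the set of points off the drawing whose face is unbounded. For a finite graph
the drawing is compact, so exactly one face is unbounded and this set is that face. -/
def outerFace (D : G.PlaneDrawing) : Set (EuclideanSpace ℝ (Fin 2)) :=
  {x | x ∉ D.support ∧ ¬ Bornology.IsBounded (D.face x)}

end PlaneDrawing

/-- A graph is outerplanar if it has a drawing in the plane, without crossings, in which every
vertex lies on (the boundary of) the outer face. -/
def IsOuterplanar {V : Type*} (G : SimpleGraph V) : Prop :=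
  ∃ D : G.PlaneDrawing, ∀ v : V, D.point v ∈ frontier D.outerFace

/-- A graph is biconnected if it is connected and the removal of any one vertex does not
disconnect it, that is, it has no cut vertex. -/
def IsBiconnected {V : Type*} (G : SimpleGraph V) : Prop :=
  G.Connected ∧ ∀ v : V, (G.induce {v}ᶜ).Preconnected

/-- Two vertices are alike if they have the same neighbours. -/
def Alike {V : Type*} (G : SimpleGraph V) (u v : V) : Prop :=
  G.neighborSet u = G.neighborSet v

end SimpleGraph

/-!
Two alike vertices of a biconnected graph with at least five vertices give a theta graph, that is,
two vertices joined by three internally disjoint paths of length at least two: either `u` and `v`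
have three common neighbours, or they have exactly two, `a` and `b`, and besides `a - u - b` and
`a - v - b` there is a third path from `a` to `b` through a fifth vertex
(`SimpleGraph.IsBiconnected.exists_isPath_avoiding`). Each of the three paths has an inner vertex,
and in an outerplane drawing these lie on the boundary of the outer face. It remains to show that
the outer face of a theta curve cannot have points of all three open arcs on its boundary.

This is `not_exists_theta`, proved with continuous logarithms instead of the Jordan curve theorem.
Let the arcs `A₀`, `A₁`, `A₂` join `a` to `b` in `ℂ`.

* Off `Aᵢ`, the function `(z - a) / (z - b)` has a continuous logarithm `Mᵢ`, by lifting along the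
  exponential the homotopy that moves `b` to `a` along `Aᵢ` (`JoinedIn.exists_log_div_sub`). The
  `Mᵢ` are normalised to agree near infinity; wherever two of them are defined their difference
  is locally constant.
* `Mᵢ = Mⱼ` on the outer face, hence on the third open arc, which has a point on the boundary of
  that face.
* The set where `Mᵢ` differs from both other logarithms is therefore bounded with frontier in `Aᵢ`.
  Since every continuous function without zeros on an arc has a logarithm, Tietze's theorem shows
  that an arc encloses nothing (`LogAcyclic.eq_empty_of_frontier_subset`), and the set is empty.
* So all `Mᵢ` agree where they are defined, and they glue to a logarithm of `(z - a) / (z - b)` on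
  `ℂ` without `a` and `b`, which does not exist (`not_exists_log_div_sub`).
-/

open Complex Set Topology

/-! ### Continuous logarithms in the plane -/

/-- Two continuous logarithms of the same function on a preconnected set that agree at one point
agree everywhere. -/
theorem eqOn_of_exp_eqOn {X : Type*} [TopologicalSpace X] {S : Set X} (hS : IsPreconnected S)
    {g h : X → ℂ} (hg : ContinuousOn g S) (hh : ContinuousOn h S)
    (hgh : ∀ z ∈ S, exp (g z) = exp (h z)) {z₀ : X} (hz₀ : z₀ ∈ S) (h₀ : g z₀ = h z₀) :
    EqOn g h S := by
  refine isCoveringMap_exp.isSeparatedMap.eqOn_of_comp_eqOn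
    isCoveringMap_exp.isLocalHomeomorph.isLocallyInjective hS hg hh ?_ hz₀ h₀
  intro z hz
  exact Subtype.ext (hgh z hz)

theorem not_exists_log_on_sphere (c : ℂ) {r : ℝ} (hr : 0 < r) :
    ¬ ∃ g : ℂ → ℂ, ContinuousOn g (Metric.sphere c r) ∧
      ∀ z ∈ Metric.sphere c r, exp (g z) = z - c := by
  rintro ⟨g, hg, hexp⟩
  have hmem : ∀ θ : ℝ, circleMap c r θ ∈ Metric.sphere c r :=
    fun θ ↦ circleMap_mem_sphere c hr.le θ
  have hcont : Continuous fun θ : ℝ ↦ g (circleMap c r θ) :=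
    hg.comp_continuous (continuous_circleMap c r) hmem
  have key : EqOn (fun θ : ℝ ↦ g (circleMap c r θ))
      (fun θ : ℝ ↦ g (circleMap c r 0) + θ * I) univ := by
    refine eqOn_of_exp_eqOn isPreconnected_univ hcont.continuousOn
      (by fun_prop) ?_ (mem_univ 0) (by simp)
    intro θ _
    simp only [exp_add, hexp _ (hmem _)]
    simp [circleMap]
  have h := key (mem_univ (2 * Real.pi))
  have hper : circleMap c r (2 * Real.pi) = circleMap c r 0 := by
    simpa using periodic_circleMap c r 0
  simp only [hper] at h
  simp [Real.pi_ne_zero] at h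

/-- The function `(z - a) / (z - b)` has winding number one around `a`, so it has no continuous
logarithm on the twice punctured plane. -/
theorem not_exists_log_div_sub {a b : ℂ} (hab : a ≠ b) :
    ¬ ∃ g : ℂ → ℂ, ContinuousOn g {a, b}ᶜ ∧
      ∀ z ∈ ({a, b}ᶜ : Set ℂ), exp (g z) = (z - a) / (z - b) := by
  rintro ⟨g, hg, hexp⟩
  have hab' : a - b ≠ 0 := sub_ne_zero.2 hab
  have hpos : 0 < ‖a - b‖ := norm_pos_iff.2 hab'
  have hr : 0 < ‖a - b‖ / 2 := half_pos hpos
  have hsub : ∀ z ∈ Metric.sphere a (‖a - b‖ / 2), z ≠ a ∧ z ≠ b := by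
    intro z hz
    rw [mem_sphere_iff_norm] at hz
    constructor
    · rintro rfl
      simp only [sub_self, norm_zero] at hz
      linarith
    · rintro rfl
      rw [norm_sub_rev] at hz
      linarith
  -- On this circle `z - b` stays close to `a - b`, so the principal logarithm of the quotient
  -- of the two is continuous.
  have hslit : ∀ z ∈ Metric.sphere a (‖a - b‖ / 2), 1 + (z - a) / (a - b) ∈ slitPlane := by
    intro z hz
    rw [mem_sphere_iff_norm] at hz
    apply mem_slitPlane_of_norm_lt_one
    rw [norm_div, hz, div_div, div_lt_one (by positivity)]
    linarith
  refine not_exists_log_on_sphere a hr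
    ⟨fun z ↦ g z + (log (1 + (z - a) / (a - b)) + log (a - b)), ?_, ?_⟩
  · refine (hg.mono ?_).add ((ContinuousOn.clog (by fun_prop) hslit).add continuousOn_const)
    intro z hz
    simpa using hsub z hz
  · intro z hz
    obtain ⟨hza, hzb⟩ := hsub z hz
    have hzb' : z - b ≠ 0 := sub_ne_zero.2 hzb
    rw [exp_add, exp_add, exp_log (slitPlane_ne_zero (hslit z hz)), exp_log hab',
      hexp z (by simp [hza, hzb])]
    field_simp
    ring

/-- A path from `a` to `b` inside `A` provides, by lifting the homotopy that moves `b` to `a`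
along the path, a continuous logarithm of `(z - a) / (z - b)` off `A`. -/
theorem JoinedIn.exists_log_div_sub {A : Set ℂ} {a b : ℂ} (h : JoinedIn A a b) :
    ∃ g : ℂ → ℂ, ContinuousOn g Aᶜ ∧ ∀ z ∈ Aᶜ, exp (g z) = (z - a) / (z - b) := by
  obtain ⟨γ, hγ⟩ := h.symm
  have hne : ∀ (t : unitInterval) (z : (Aᶜ : Set ℂ)), (z : ℂ) - γ t ≠ 0 := by
    intro t z hz
    exact z.2 (sub_eq_zero.1 hz ▸ hγ t)
  have hb : b ∈ A := h.target_mem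
  have hneb : ∀ z : (Aᶜ : Set ℂ), (z : ℂ) - b ≠ 0 := by
    intro z hz
    exact z.2 (sub_eq_zero.1 hz ▸ hb)
  let H : C(unitInterval × (Aᶜ : Set ℂ), {z : ℂ // z ≠ 0}) :=
    ⟨fun x ↦ ⟨((x.2 : ℂ) - γ x.1) / (x.2 - b), div_ne_zero (hne _ _) (hneb _)⟩, by
      refine Continuous.subtype_mk (Continuous.div (by fun_prop) (by fun_prop) ?_) _
      exact fun x ↦ hneb x.2⟩
  have H0 : ∀ z : (Aᶜ : Set ℂ), H (0, z) =
      (fun z : ℂ ↦ (⟨_, z.exp_ne_zero⟩ : {z : ℂ // z ≠ 0}))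
        ((ContinuousMap.const _ 0 : C(_, ℂ)) z) := by
    intro z
    apply Subtype.ext
    simp [H, div_self (hneb z)]
  let F := isCoveringMap_exp.liftHomotopy H (ContinuousMap.const _ 0) H0
  have hF : ∀ z : (Aᶜ : Set ℂ), exp (F (1, z)) = (z - a) / (z - b) := by
    intro z
    have : exp (F (1, z)) = H (1, z) :=
      congrArg Subtype.val (congrFun (isCoveringMap_exp.liftHomotopy_lifts H _ H0) (1, z))
    rw [this]
    simp [H]
  classical
  refine ⟨fun z ↦ if hz : z ∈ Aᶜ then F (1, ⟨z, hz⟩) else 0, ?_, ?_⟩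
  · rw [continuousOn_iff_continuous_domRestrict]
    have : Aᶜ.domRestrict (fun z ↦ if hz : z ∈ Aᶜ then F (1, ⟨z, hz⟩) else 0) =
        fun z : (Aᶜ : Set ℂ) ↦ F (1, z) := by
      ext z
      exact dif_pos z.2
    rw [this]
    fun_prop
  · intro z hz
    simpa only [dif_pos hz] using hF ⟨z, hz⟩

/-- A subset of the plane is log-acyclic if every continuous function without zeros on it has a
continuous logarithm. For compact sets this says that the set does not separate the plane; here it
stands for the property of simple arcs that makes them non-separating. -/
def LogAcyclic (K : Set ℂ) : Prop :=
  ∀ f : ℂ → ℂ, ContinuousOn f K → (∀ z ∈ K, f z ≠ 0) →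
    ∃ g : ℂ → ℂ, ContinuousOn g K ∧ ∀ z ∈ K, exp (g z) = f z

theorem logAcyclic_singleton (x : ℂ) : LogAcyclic {x} := by
  intro f _ hf
  exact ⟨fun z ↦ log (f z), continuousOn_singleton _ _, fun z hz ↦ exp_log (hf z hz)⟩

theorem LogAcyclic.union {K L : Set ℂ} {x : ℂ} (hK : LogAcyclic K) (hL : LogAcyclic L)
    (hKc : IsClosed K) (hLc : IsClosed L) (hx : x ∈ K ∩ L) (hKL : K ∩ L ⊆ {x}) :
    LogAcyclic (K ∪ L) := by
  classical
  intro f hf hf0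
  obtain ⟨g, hg, hgf⟩ := hK f (hf.mono subset_union_left) fun z hz ↦ hf0 z (.inl hz)
  obtain ⟨h, hh, hhf⟩ := hL f (hf.mono subset_union_right) fun z hz ↦ hf0 z (.inr hz)
  have hexp : ∀ z ∈ L, exp (h z + (g x - h x)) = f z := by
    intro z hz
    rw [exp_add, exp_sub, hgf x hx.1, hhf x hx.2, div_self (hf0 x (.inl hx.1)), mul_one, hhf z hz]
  have hgK : EqOn (fun z ↦ if z ∈ K then g z else h z + (g x - h x)) g K := by
    intro z hz
    simp only [if_pos hz]
  have hgL : EqOn (fun z ↦ if z ∈ K then g z else h z + (g x - h x))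
      (fun z ↦ h z + (g x - h x)) L := by
    intro z hz
    by_cases hzK : z ∈ K
    · obtain rfl : z = x := hKL ⟨hzK, hz⟩
      simp [hzK]
    · simp [hzK]
  refine ⟨_, (hg.congr hgK).union_of_isClosed
    ((hh.add continuousOn_const).congr hgL) hKc hLc, ?_⟩
  rintro z (hz | hz)
  · exact (congrArg exp (hgK hz)).trans (hgf z hz)
  · exact (congrArg exp (hgL hz)).trans (hexp z hz)

theorem logAcyclic_range {c : unitInterval → ℂ} (hc : Continuous c)
    (hinj : Function.Injective c) : LogAcyclic (range c) := by
  intro f hf hf0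
  have hfc : Continuous (f ∘ c) := hf.comp_continuous hc mem_range_self
  let γ : C(unitInterval, {z : ℂ // z ≠ 0}) :=
    ⟨fun t ↦ ⟨f (c t), hf0 _ (mem_range_self t)⟩, hfc.subtype_mk _⟩
  obtain ⟨Γ, hΓ, -⟩ := isCoveringMap_exp.exists_path_lifts γ (log (f (c 0)))
    (Subtype.ext (exp_log (hf0 _ (mem_range_self 0))).symm)
  obtain ⟨g, hg⟩ := ContinuousMap.exists_extension (hc.isClosedEmbedding hinj) Γ
  refine ⟨g, g.continuous.continuousOn, ?_⟩
  rintro _ ⟨t, rfl⟩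
  have h1 : g (c t) = Γ t := DFunLike.congr_fun hg t
  have h2 : exp (Γ t) = f (c t) := congrArg Subtype.val (congrFun hΓ t)
  rw [h1, h2]

/-- A closed log-acyclic set does not enclose a region. If `p` were in a bounded region `U` with
frontier in `K`, extending a logarithm of `z - p` from `K` to `U` would give a function without
zeros on the plane which is `z - p` near infinity. -/
theorem LogAcyclic.eq_empty_of_frontier_subset {K U : Set ℂ} (hK : LogAcyclic K)
    (hKc : IsClosed K) (hUb : Bornology.IsBounded U) (hUK : Disjoint U K)
    (hfr : frontier U ⊆ K) : U = ∅ := by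
  classical
  by_contra hne
  obtain ⟨p, hp⟩ := nonempty_iff_ne_empty.2 hne
  obtain ⟨g, hg, hgf⟩ := hK (fun z ↦ z - p) (by fun_prop) (by
    intro z hz h0
    exact disjoint_left.1 hUK hp (sub_eq_zero.1 h0 ▸ hz))
  obtain ⟨G, hG⟩ := ContinuousMap.exists_restrict_eq hKc ⟨K.domRestrict g, hg.domRestrict⟩
  have hGg : ∀ z ∈ K, G z = g z := fun z hz ↦ DFunLike.congr_fun hG ⟨z, hz⟩
  let h : C(ℂ, ℂ) := ⟨fun z ↦ if z ∈ U then exp (G z) else z - p, by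
    refine Continuous.if ?_ (by fun_prop) (by fun_prop)
    intro z hz
    rw [hGg z (hfr hz), hgf z (hfr hz)]⟩
  have hh0 : ∀ z, h z ∈ ({0}ᶜ : Set ℂ) := by
    intro z
    by_cases hz : z ∈ U
    · simp [h, hz, exp_ne_zero]
    · have : z ≠ p := fun e ↦ hz (e ▸ hp)
      simp [h, hz, sub_eq_zero, this]
  obtain ⟨F, ⟨-, hF⟩, -⟩ := isCoveringMapOn_exp.existsUnique_continuousMap_lifts h
    (a₀ := 0) (e₀ := log (h 0)) (exp_log (hh0 0)) hh0
  obtain ⟨R, hR⟩ := hUb.subset_ball p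
  have hRpos : 0 < R := Metric.pos_of_mem_ball (hR hp)
  refine not_exists_log_on_sphere p hRpos ⟨F, F.continuous.continuousOn, ?_⟩
  intro z hz
  have hzU : z ∉ U := by
    intro hzU
    exact (Metric.mem_ball.1 (hR hzU)).ne hz
  have : exp (F z) = h z := congrFun hF z
  simpa [h, hzU] using this

theorem isPreconnected_setOf_lt_norm {R : ℝ} (hR : 0 < R) : IsPreconnected {z : ℂ | R < ‖z‖} := by
  have : {z : ℂ | R < ‖z‖} = exp '' {w : ℂ | Real.log R < w.re} := by
    ext z
    constructor
    · intro hz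
      have hz0 : z ≠ 0 := norm_pos_iff.1 (hR.trans hz)
      refine ⟨log z, ?_, exp_log hz0⟩
      simpa [log_re] using Real.log_lt_log hR hz
    · rintro ⟨w, hw, rfl⟩
      simpa [norm_exp] using (Real.log_lt_iff_lt_exp hR).1 hw
  rw [this]
  exact (convex_halfSpace_re_gt _).isPreconnected.image _ continuous_exp.continuousOn

/-! ### Theta curves -/

/-- Logarithms of `(z - a) / (z - b)` off each of finitely many bounded sets containing a path from
`a` to `b` can be chosen to agree near infinity. -/
theorem exists_logs_div_sub {ι : Type*} [Finite ι] {A : ι → Set ℂ} {a b : ℂ}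
    (hb : ∀ i, Bornology.IsBounded (A i)) (hj : ∀ i, JoinedIn (A i) a b) :
    ∃ (M : ι → ℂ → ℂ) (R : ℝ), (∀ i, ContinuousOn (M i) (A i)ᶜ) ∧
      (∀ i, ∀ z ∉ A i, exp (M i z) = (z - a) / (z - b)) ∧
      (∀ i, ∀ z, R < ‖z‖ → z ∉ A i) ∧ ∀ i j z, R < ‖z‖ → M i z = M j z := by
  choose L hL hLexp using fun i ↦ (hj i).exists_log_div_sub
  obtain ⟨R, hRpos, hR⟩ := (Bornology.isBounded_iUnion.2 hb).exists_pos_norm_le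
  have hout : ∀ i, ∀ z : ℂ, R < ‖z‖ → z ∉ A i :=
    fun i z hz hzA ↦ hz.not_ge (hR z (mem_iUnion.2 ⟨i, hzA⟩))
  let w : ℂ := ((R + 1 : ℝ) : ℂ)
  have hw : R < ‖w‖ := by
    rw [norm_real, Real.norm_eq_abs, abs_of_pos (by linarith)]
    linarith
  have hMexp : ∀ i, ∀ z ∉ A i, exp (L i z - L i w + log ((w - a) / (w - b))) =
      (z - a) / (z - b) := by
    intro i z hz
    have h0 : (w - a) / (w - b) ≠ 0 := hLexp i w (hout i w hw) ▸ exp_ne_zero _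
    rw [exp_add, exp_sub, exp_log h0, hLexp i z hz, hLexp i w (hout i w hw), div_mul_cancel₀ _ h0]
  have hMc : ∀ i, ContinuousOn (fun z ↦ L i z - L i w + log ((w - a) / (w - b))) (A i)ᶜ :=
    fun i ↦ ((hL i).sub continuousOn_const).add continuousOn_const
  refine ⟨fun i z ↦ L i z - L i w + log ((w - a) / (w - b)), R, hMc, hMexp, hout, ?_⟩
  intro i j z hz
  refine eqOn_of_exp_eqOn (isPreconnected_setOf_lt_norm hRpos) ((hMc i).mono fun y hy ↦ hout i y hy)
    ((hMc j).mono fun y hy ↦ hout j y hy) ?_ (z₀ := w) hw (by simp) hz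
  intro y hy
  rw [hMexp i y (hout i y hy), hMexp j y (hout j y hy)]

/-- Let three log-acyclic compact sets join `a` to `b` and meet pairwise only in `a` and `b`. Then
there is no set `O`, made of points joined to infinity in the complement of their union, whose
closure meets every piece of each of the three sets left by the removal of `a` and `b`.

The logarithms of `(z - a) / (z - b)` off the three sets are compared: the region where
the `i`-th differs from the two others is enclosed by the `i`-th set alone, hence empty, so that
all three agree and glue to a logarithm on the plane without `a` and `b`. -/
theorem not_exists_theta {A : Fin 3 → Set ℂ} {a b : ℂ} (hab : a ≠ b)
    (hc : ∀ i, IsCompact (A i)) (hacyc : ∀ i, LogAcyclic (A i)) (hj : ∀ i, JoinedIn (A i) a b)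
    (hinter : ∀ i j, i ≠ j → A i ∩ A j ⊆ {a, b}) (O : Set ℂ)
    (hO : ∀ x ∈ O, ∃ C, IsPreconnected C ∧ x ∈ C ∧ ¬ Bornology.IsBounded C ∧
      ∀ i, Disjoint C (A i))
    (hA : ∀ i, ∀ y ∈ A i, y ≠ a → y ≠ b → ∃ S, IsPreconnected S ∧ y ∈ S ∧ S ⊆ A i ∧
      a ∉ S ∧ b ∉ S ∧ (S ∩ closure O).Nonempty) : False := by
  classical
  obtain ⟨M, R, hM, hMexp, hout, hagree⟩ := exists_logs_div_sub (fun i ↦ (hc i).isBounded) hj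
  have haA : ∀ i, a ∈ A i := fun i ↦ (hj i).source_mem
  have hbA : ∀ i, b ∈ A i := fun i ↦ (hj i).target_mem
  have hopen : ∀ i j, IsOpen ((A i)ᶜ ∩ (A j)ᶜ) := fun i j ↦
    (hc i).isClosed.isOpen_compl.inter (hc j).isClosed.isOpen_compl
  have hprop : ∀ {i j : Fin 3} {S : Set ℂ}, IsPreconnected S → S ⊆ (A i)ᶜ ∩ (A j)ᶜ →
      ∀ {x}, x ∈ S → M i x = M j x → ∀ {y}, y ∈ S → M i y = M j y := by
    intro i j S hS hSA x hx hxe y hy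
    refine eqOn_of_exp_eqOn hS ((hM i).mono fun z hz ↦ (hSA hz).1)
      ((hM j).mono fun z hz ↦ (hSA hz).2) ?_ hx hxe hy
    intro z hz
    rw [hMexp i z (hSA hz).1, hMexp j z (hSA hz).2]
  have hball : ∀ {i j : Fin 3} {x : ℂ}, x ∉ A i → x ∉ A j → ∃ r > 0,
      Metric.ball x r ⊆ (A i)ᶜ ∩ (A j)ᶜ ∧
      ∀ y ∈ Metric.ball x r, (M i x = M j x ↔ M i y = M j y) := by
    intro i j x hxi hxj
    obtain ⟨r, hr, hsub⟩ := Metric.isOpen_iff.1 (hopen i j) x ⟨hxi, hxj⟩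
    have hpre : IsPreconnected (Metric.ball x r) := (convex_ball x r).isPreconnected
    have hxr := Metric.mem_ball_self (x := x) hr
    exact ⟨r, hr, hsub, fun y hy ↦
      ⟨fun h ↦ hprop hpre hsub hxr h hy, fun h ↦ hprop hpre hsub hy h hxr⟩⟩
  -- On the third set, off `a` and `b`, the two other logarithms agree since they agree near
  -- infinity.
  have hthird : ∀ i j k : Fin 3, i ≠ k → j ≠ k → ∀ y ∈ A k, y ≠ a → y ≠ b → M i y = M j y := by
    intro i j k hik hjk y hy hya hyb
    obtain ⟨S, hS, hyS, hSA, haS, hbS, x, hxS, hxO⟩ := hA k y hy hya hyb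
    have hoff : ∀ l, l ≠ k → ∀ z ∈ S, z ∉ A l := by
      intro l hl z hz hzl
      rcases hinter l k hl ⟨hzl, hSA hz⟩ with rfl | rfl
      · exact haS hz
      · exact hbS hz
    obtain ⟨r, hr, -, hiff⟩ := hball (hoff i hik x hxS) (hoff j hjk x hxS)
    obtain ⟨o, ho, hor⟩ := Metric.mem_closure_iff.1 hxO r hr
    obtain ⟨C, hC, hoC, hCunb, hCA⟩ := hO o ho
    obtain ⟨w, hwC, hw⟩ : ∃ w ∈ C, R < ‖w‖ := by
      by_contra! h
      exact hCunb (isBounded_iff_forall_norm_le.2 ⟨R, h⟩)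
    have ho' : M i o = M j o :=
      hprop hC (fun z hz ↦ ⟨disjoint_left.1 (hCA i) hz, disjoint_left.1 (hCA j) hz⟩) hwC
        (hagree i j w hw) hoC
    have hx : M i x = M j x := (hiff o (by rwa [Metric.mem_ball, dist_comm])).2 ho'
    exact hprop hS (fun z hz ↦ ⟨hoff i hik z hz, hoff j hjk z hz⟩) hxS hx hyS
  let N : Fin 3 → Fin 3 → Set ℂ := fun i j ↦ {z | z ∉ A i ∧ z ∉ A j ∧ M i z ≠ M j z}
  have hNopen : ∀ i j, IsOpen (N i j) := by
    intro i j
    rw [Metric.isOpen_iff]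
    rintro z ⟨hzi, hzj, hz⟩
    obtain ⟨r, hr, hsub, hiff⟩ := hball hzi hzj
    exact ⟨r, hr, fun y hy ↦ ⟨(hsub hy).1, (hsub hy).2, fun h ↦ hz ((hiff y hy).2 h)⟩⟩
  have hNclosure : ∀ {i j z}, z ∉ A i → z ∉ A j → M i z = M j z → z ∉ closure (N i j) := by
    intro i j z hzi hzj hz hcl
    obtain ⟨r, hr, -, hiff⟩ := hball hzi hzj
    obtain ⟨y, hy, hyr⟩ := Metric.mem_closure_iff.1 hcl r hr
    exact hy.2.2 ((hiff y (by rwa [Metric.mem_ball, dist_comm])).1 hz)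
  have hempty : ∀ i j k : Fin 3, i ≠ j → i ≠ k → j ≠ k → N i j ∩ N i k = ∅ := by
    intro i j k hij hik hjk
    refine (hacyc i).eq_empty_of_frontier_subset (hc i).isClosed ?_ ?_ ?_
    · refine isBounded_iff_forall_norm_le.2 ⟨R, fun z hz ↦ ?_⟩
      by_contra! hzR
      exact hz.1.2.2 (hagree i j z hzR)
    · exact disjoint_left.2 fun z hz ↦ hz.1.1
    · intro z hz
      by_contra hzi
      have hza : z ≠ a := fun h ↦ hzi (h ▸ haA i)
      have hzb : z ≠ b := fun h ↦ hzi (h ▸ hbA i)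
      have hcl1 : z ∈ closure (N i j) := closure_mono inter_subset_left hz.1
      have hcl2 : z ∈ closure (N i k) := closure_mono inter_subset_right hz.1
      have hzn : z ∉ N i j ∩ N i k := by
        rw [((hNopen i j).inter (hNopen i k)).frontier_eq] at hz
        exact hz.2
      by_cases hzj : z ∈ A j
      · have hzk : z ∉ A k := fun h ↦ by
          rcases hinter j k hjk ⟨hzj, h⟩ with h | h
          exacts [hza h, hzb h]
        exact hNclosure hzi hzk (hthird i k j hij hjk.symm z hzj hza hzb) hcl2
      · by_cases hzk : z ∈ A k
        · exact hNclosure hzi hzj (hthird i j k hik hjk z hzk hza hzb) hcl1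
        · refine hzn ⟨⟨hzi, hzj, fun h ↦ hNclosure hzi hzj h hcl1⟩,
            ⟨hzi, hzk, fun h ↦ hNclosure hzi hzk h hcl2⟩⟩
  have h01 : ∀ z, z ∉ A 0 → z ∉ A 1 → M 0 z = M 1 z := by
    intro z h0 h1
    by_contra hne
    by_cases h2 : z ∈ A 2
    · exact hne (hthird 0 1 2 (by decide) (by decide) z h2 (fun h ↦ h0 (h ▸ haA 0))
        (fun h ↦ h0 (h ▸ hbA 0)))
    · by_cases h02 : M 0 z = M 2 z
      · exact (hempty 1 0 2 (by decide) (by decide) (by decide)).le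
          (show z ∈ N 1 0 ∩ N 1 2 from ⟨⟨h1, h0, Ne.symm hne⟩,
            ⟨h1, h2, fun h ↦ hne (h02.trans h.symm)⟩⟩)
      · exact (hempty 0 1 2 (by decide) (by decide) (by decide)).le
          (show z ∈ N 0 1 ∩ N 0 2 from ⟨⟨h0, h1, hne⟩, ⟨h0, h2, h02⟩⟩)
  let g : ℂ → ℂ := fun z ↦ if z ∈ A 0 then M 1 z else M 0 z
  have hg0 : EqOn g (M 0) (A 0)ᶜ := fun z hz ↦ if_neg hz
  have hg1 : EqOn g (M 1) (A 1)ᶜ := by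
    intro z hz
    by_cases h0 : z ∈ A 0
    · exact if_pos h0
    · exact (if_neg h0).trans (h01 z h0 hz)
  have hcover : ∀ z ∈ ({a, b}ᶜ : Set ℂ), z ∈ (A 0)ᶜ ∪ (A 1)ᶜ := by
    intro z hz
    by_contra h
    rw [← compl_inter, notMem_compl_iff] at h
    exact hz (hinter 0 1 (by decide) h)
  refine not_exists_log_div_sub hab ⟨g, ?_, ?_⟩
  · exact (((hM 0).congr hg0).union_of_isOpen ((hM 1).congr hg1) (hc 0).isClosed.isOpen_compl
      (hc 1).isClosed.isOpen_compl).mono hcover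
  · intro z hz
    rcases hcover z hz with h | h
    · rw [hg0 h, hMexp 0 z h]
    · rw [hg1 h, hMexp 1 z h]

/-! ### Paths of a drawn graph as subsets of the plane -/

namespace SimpleGraph.PlaneDrawing

/-- The identification of the Euclidean plane with the complex numbers. -/
noncomputable def planeEquiv : EuclideanSpace ℝ (Fin 2) ≃ₗᵢ[ℝ] ℂ :=
  Complex.orthonormalBasisOneI.repr.symm

variable {V : Type*} {G : SimpleGraph V} (D : G.PlaneDrawing)

/-- The position of a vertex, as a complex number. -/
noncomputable def pt (v : V) : ℂ := planeEquiv (D.point v)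

/-- The curve of an edge, in the complex plane. -/
noncomputable def param (e : G.edgeSet) (τ : unitInterval) : ℂ := planeEquiv (D.curve e τ)

/-- The part of the drawing, in the complex plane, that is covered by the vertices and edges of a
walk. -/
def trace {s t : V} (p : G.Walk s t) : Set ℂ :=
  D.pt '' {v | v ∈ p.support} ∪ ⋃ (e : G.edgeSet) (_ : (e : Sym2 V) ∈ p.edges), range (D.param e)

theorem pt_injective : Function.Injective D.pt :=
  planeEquiv.injective.comp D.point_injective

theorem continuous_param (e : G.edgeSet) : Continuous (D.param e) :=
  planeEquiv.continuous.comp (D.curve_continuous e)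

theorem param_injective (e : G.edgeSet) : Function.Injective (D.param e) :=
  planeEquiv.injective.comp (D.curve_injective e)

theorem sym2_param (e : G.edgeSet) :
    s(D.param e 0, D.param e 1) = Sym2.map D.pt (e : Sym2 V) := by
  have h := congrArg (Sym2.map planeEquiv) (D.curve_ends e)
  rw [Sym2.map_map] at h
  exact h

theorem mem_of_pt_mem_range {e : G.edgeSet} {v : V} (h : D.pt v ∈ range (D.param e)) :
    v ∈ (e : Sym2 V) := by
  obtain ⟨τ, hτ⟩ := h
  exact D.mem_of_curve_eq_point e τ v (planeEquiv.injective hτ)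

theorem range_param_inter {e f : G.edgeSet} (hef : e ≠ f) {y : ℂ} (he : y ∈ range (D.param e))
    (hf : y ∈ range (D.param f)) : ∃ v, D.pt v = y := by
  obtain ⟨τ, rfl⟩ := he
  obtain ⟨σ, hσ⟩ := hf
  obtain ⟨v, hv⟩ := D.inter_subset e f hef ⟨⟨τ, rfl⟩, ⟨σ, planeEquiv.injective hσ⟩⟩
  exact ⟨v, congrArg planeEquiv hv⟩

/-- An end of an edge is the position of the curve at one of the two ends of the interval. -/
theorem exists_param_eq_pt {e : G.edgeSet} {v : V} (hv : v ∈ (e : Sym2 V)) :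
    D.param e 0 = D.pt v ∨ D.param e 1 = D.pt v := by
  have h : D.pt v ∈ Sym2.map D.pt (e : Sym2 V) := Sym2.mem_map.2 ⟨v, hv, rfl⟩
  rw [← D.sym2_param e, Sym2.mem_iff] at h
  exact h.imp Eq.symm Eq.symm

/-- Both ends of the interval are mapped to ends of the edge. -/
theorem exists_pt_eq_param (e : G.edgeSet) :
    (∃ v, D.pt v = D.param e 0) ∧ ∃ v, D.pt v = D.param e 1 := by
  have h0 : D.param e 0 ∈ Sym2.map D.pt (e : Sym2 V) := by
    rw [← D.sym2_param e]; exact Sym2.mem_mk_left _ _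
  have h1 : D.param e 1 ∈ Sym2.map D.pt (e : Sym2 V) := by
    rw [← D.sym2_param e]; exact Sym2.mem_mk_right _ _
  obtain ⟨v, -, hv⟩ := Sym2.mem_map.1 h0
  obtain ⟨w, -, hw⟩ := Sym2.mem_map.1 h1
  exact ⟨⟨v, hv⟩, ⟨w, hw⟩⟩

theorem pt_mem_range {e : G.edgeSet} {v : V} (hv : v ∈ (e : Sym2 V)) :
    D.pt v ∈ range (D.param e) := by
  rcases D.exists_param_eq_pt hv with h | h
  exacts [⟨0, h⟩, ⟨1, h⟩]

theorem joinedIn_range_param {e : G.edgeSet} {v w : V} (hv : v ∈ (e : Sym2 V))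
    (hw : w ∈ (e : Sym2 V)) : JoinedIn (range (D.param e)) (D.pt v) (D.pt w) :=
  have : PathConnectedSpace unitInterval := isPathConnected_iff_pathConnectedSpace.1
    ((convex_Icc (0 : ℝ) 1).isPathConnected ⟨0, unitInterval.zero_mem⟩)
  (isPathConnected_range (D.continuous_param e)).joinedIn _ (D.pt_mem_range hv) _
    (D.pt_mem_range hw)

/-- Removing the far end from the curve of an edge leaves a connected set, which contains no vertex
but the near end. -/
theorem exists_isPreconnected_subset_range_param {e : G.edgeSet} {w : V} (hw : w ∈ (e : Sym2 V)) :
    ∃ S, IsPreconnected S ∧ D.pt w ∈ S ∧ S ⊆ range (D.param e) ∧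
      (∀ x, D.pt x ∈ S → x = w) ∧ ∀ y ∈ range (D.param e), y ∈ S ∨ ∃ x, D.pt x = y := by
  have hcont := D.continuous_param e
  have hinj := D.param_injective e
  have key : ∀ x, D.pt x ∈ range (D.param e) → D.pt x = D.param e 0 ∨ D.pt x = D.param e 1 :=
    fun x hx ↦ (D.exists_param_eq_pt (D.mem_of_pt_mem_range hx)).imp Eq.symm Eq.symm
  rcases D.exists_param_eq_pt hw with h | h
  · refine ⟨D.param e '' Iio 1, isPreconnected_Iio.image _ hcont.continuousOn,
      ⟨0, mem_Iio.2 zero_lt_one, h⟩, image_subset_range _ _, ?_, ?_⟩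
    · rintro x ⟨τ, hτ, hx⟩
      rcases key x ⟨τ, hx⟩ with h' | h'
      · exact D.pt_injective (h'.trans h)
      · exact absurd (hinj (hx.trans h')) (ne_of_lt hτ)
    · rintro _ ⟨τ, rfl⟩
      rcases eq_or_ne τ 1 with rfl | hτ
      · exact .inr (D.exists_pt_eq_param e).2
      · exact .inl ⟨τ, unitInterval.lt_one_iff_ne_one.2 hτ, rfl⟩
  · refine ⟨D.param e '' Ioi 0, isPreconnected_Ioi.image _ hcont.continuousOn,
      ⟨1, mem_Ioi.2 zero_lt_one, h⟩, image_subset_range _ _, ?_, ?_⟩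
    · rintro x ⟨τ, hτ, hx⟩
      rcases key x ⟨τ, hx⟩ with h' | h'
      · exact absurd (hinj (hx.trans h')) (ne_of_gt hτ)
      · exact D.pt_injective (h'.trans h)
    · rintro _ ⟨τ, rfl⟩
      rcases eq_or_ne τ 0 with rfl | hτ
      · exact .inr (D.exists_pt_eq_param e).1
      · exact .inl ⟨τ, unitInterval.pos_iff_ne_zero.2 hτ, rfl⟩

theorem mem_trace {s t : V} {p : G.Walk s t} {y : ℂ} :
    y ∈ D.trace p ↔ (∃ v ∈ p.support, D.pt v = y) ∨
      ∃ e : G.edgeSet, (e : Sym2 V) ∈ p.edges ∧ y ∈ range (D.param e) := by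
  simp [trace]

theorem mem_support_of_pt_mem_trace {s t v : V} {p : G.Walk s t} (h : D.pt v ∈ D.trace p) :
    v ∈ p.support := by
  rcases D.mem_trace.1 h with ⟨w, hw, hwv⟩ | ⟨e, he, hev⟩
  · exact D.pt_injective hwv ▸ hw
  · exact p.mem_support_of_mem_edges he (D.mem_of_pt_mem_range hev)

theorem trace_nil (s : V) : D.trace (Walk.nil : G.Walk s s) = {D.pt s} := by
  simp [trace]

theorem trace_cons {s u t : V} (h : G.Adj s u) (p : G.Walk u t) :
    D.trace (Walk.cons h p) = range (D.param ⟨s(s, u), h⟩) ∪ D.trace p := by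
  ext y
  rw [mem_union, mem_trace, mem_trace]
  simp only [Walk.support_cons, Walk.edges_cons, List.mem_cons]
  constructor
  · rintro (⟨v, rfl | hv, rfl⟩ | ⟨e, he | he, hy⟩)
    · exact .inl (D.pt_mem_range (Sym2.mem_mk_left _ _))
    · exact .inr (.inl ⟨v, hv, rfl⟩)
    · obtain rfl : e = ⟨s(s, u), h⟩ := Subtype.ext he
      exact .inl hy
    · exact .inr (.inr ⟨e, he, hy⟩)
  · rintro (hy | ⟨v, hv, rfl⟩ | ⟨e, he, hy⟩)
    · exact .inr ⟨_, .inl rfl, hy⟩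
    · exact .inl ⟨v, .inr hv, rfl⟩
    · exact .inr ⟨e, .inr he, hy⟩

theorem isCompact_trace {s t : V} (p : G.Walk s t) : IsCompact (D.trace p) := by
  induction p with
  | nil => rw [trace_nil]; exact isCompact_singleton
  | cons h p ih => rw [trace_cons]; exact (isCompact_range (D.continuous_param _)).union ih

theorem joinedIn_trace {s t : V} (p : G.Walk s t) :
    JoinedIn (D.trace p) (D.pt s) (D.pt t) := by
  induction p with
  | nil => rw [trace_nil]; exact JoinedIn.refl (mem_singleton _)
  | cons h p ih =>
    rw [trace_cons]
    exact ((D.joinedIn_range_param (Sym2.mem_mk_left _ _) (Sym2.mem_mk_right _ _)).mono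
      subset_union_left).trans (ih.mono subset_union_right)

theorem logAcyclic_trace {s t : V} {p : G.Walk s t} (hp : p.IsPath) : LogAcyclic (D.trace p) := by
  induction p with
  | nil => rw [trace_nil]; exact logAcyclic_singleton _
  | @cons s u t h p ih =>
    rw [Walk.cons_isPath_iff] at hp
    rw [trace_cons]
    refine (logAcyclic_range (D.continuous_param _) (D.param_injective _)).union (ih hp.1)
      (isCompact_range (D.continuous_param _)).isClosed (D.isCompact_trace p).isClosed (x := D.pt u)
      ⟨D.pt_mem_range (Sym2.mem_mk_right _ _), D.mem_trace.2 (.inl ⟨u, p.start_mem_support, rfl⟩)⟩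
      ?_
    rintro y ⟨hy, hyp⟩
    obtain ⟨x, rfl⟩ : ∃ x, D.pt x = y := by
      rcases D.mem_trace.1 hyp with ⟨v, -, hv⟩ | ⟨f, hf, hyf⟩
      · exact ⟨v, hv⟩
      · refine D.range_param_inter ?_ hy hyf
        rintro rfl
        exact hp.2 (p.fst_mem_support_of_mem_edges hf)
    have hxp := D.mem_support_of_pt_mem_trace hyp
    rcases Sym2.mem_iff.1 (D.mem_of_pt_mem_range hy) with rfl | rfl
    · exact absurd hxp hp.2
    · rfl

theorem trace_subset {s t : V} (p : G.Walk s t) : D.trace p ⊆ planeEquiv '' D.support := by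
  intro y hy
  rcases D.mem_trace.1 hy with ⟨v, -, rfl⟩ | ⟨e, -, τ, rfl⟩
  · exact ⟨_, .inl ⟨v, rfl⟩, rfl⟩
  · exact ⟨_, .inr (mem_iUnion.2 ⟨e, τ, rfl⟩), rfl⟩

/-- In a drawing with all vertices on the outer face, no two vertices are the ends of three
internally disjoint paths of length at least two. -/
theorem not_exists_three_paths (hout : ∀ v, D.point v ∈ frontier D.outerFace) {s t : V}
    (hst : s ≠ t) (p : Fin 3 → G.Walk s t) (hp : ∀ i, (p i).IsPath)
    (hedge : ∀ i, s(s, t) ∉ (p i).edges)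
    (hdisj : ∀ i j, i ≠ j → ∀ v ∈ (p i).support, v ∈ (p j).support → v = s ∨ v = t) : False := by
  have hclosure : ∀ v, D.pt v ∈ closure (planeEquiv '' D.outerFace) := fun v ↦
    image_closure_subset_closure_image planeEquiv.continuous
      ⟨_, frontier_subset_closure (hout v), rfl⟩
  have hedge' : ∀ i, ∀ e ∈ (p i).edges, ∃ w ∈ e, w ≠ s ∧ w ≠ t := by
    intro i e he
    by_contra! h
    have hadj := (p i).edges_subset_edgeSet he
    refine hedge i ?_
    induction e with
    | _ x y =>
      have hxy : x ≠ y := hadj.ne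
      have hx := h x (Sym2.mem_mk_left _ _)
      have hy := h y (Sym2.mem_mk_right _ _)
      have : s(x, y) = s(s, t) := by
        rw [Sym2.eq_iff]
        grind
      rwa [← this]
  refine not_exists_theta (A := fun i ↦ D.trace (p i)) (D.pt_injective.ne hst)
    (fun i ↦ D.isCompact_trace _) (fun i ↦ D.logAcyclic_trace (hp i))
    (fun i ↦ D.joinedIn_trace _) ?_ (planeEquiv '' D.outerFace) ?_ ?_
  · rintro i j hij y ⟨hyi, hyj⟩
    have hpt : ∃ v, D.pt v = y := by
      rcases D.mem_trace.1 hyi with ⟨v, -, hv⟩ | ⟨e, he, hye⟩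
      · exact ⟨v, hv⟩
      rcases D.mem_trace.1 hyj with ⟨v, -, hv⟩ | ⟨f, hf, hyf⟩
      · exact ⟨v, hv⟩
      refine D.range_param_inter ?_ hye hyf
      rintro rfl
      obtain ⟨w, hw, hws, hwt⟩ := hedge' i _ he
      exact (hdisj i j hij w ((p i).mem_support_of_mem_edges he hw)
        ((p j).mem_support_of_mem_edges hf hw)).elim hws hwt
    obtain ⟨v, rfl⟩ := hpt
    rcases hdisj i j hij v (D.mem_support_of_pt_mem_trace hyi)
      (D.mem_support_of_pt_mem_trace hyj) with rfl | rfl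
    exacts [.inl rfl, .inr rfl]
  · rintro _ ⟨x, ⟨hx, hunb⟩, rfl⟩
    refine ⟨planeEquiv '' D.face x,
      isPreconnected_connectedComponentIn.image _ planeEquiv.continuous.continuousOn,
      mem_image_of_mem _ (mem_connectedComponentIn hx), fun hb ↦ hunb ?_, fun i ↦ ?_⟩
    · have := planeEquiv.symm.lipschitz.isBounded_image hb
      rwa [image_image, image_congr fun y _ ↦ planeEquiv.symm_apply_apply y, image_id'] at this
    · refine Disjoint.mono_right (D.trace_subset (p i)) ?_
      rw [disjoint_image_iff planeEquiv.injective]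
      exact Set.disjoint_left.2 fun y hy ↦ connectedComponentIn_subset _ _ hy
  · intro i y hy hys hyt
    by_cases hv : ∃ v, D.pt v = y
    · obtain ⟨v, rfl⟩ := hv
      exact ⟨{D.pt v}, isPreconnected_singleton, rfl, singleton_subset_iff.2 hy, Ne.symm hys,
        Ne.symm hyt, _, rfl, hclosure v⟩
    rcases D.mem_trace.1 hy with ⟨v, -, h⟩ | ⟨e, he, hye⟩
    · exact absurd ⟨v, h⟩ hv
    obtain ⟨w, hw, hws, hwt⟩ := hedge' i _ he
    obtain ⟨S, hS, hwS, hSe, hSpt, hSy⟩ := D.exists_isPreconnected_subset_range_param hw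
    exact ⟨S, hS, (hSy y hye).resolve_right hv,
      fun z hz ↦ D.mem_trace.2 (.inr ⟨e, he, hSe hz⟩), fun h ↦ hws (hSpt s h).symm,
      fun h ↦ hwt (hSpt t h).symm, _, hwS, hclosure w⟩

end SimpleGraph.PlaneDrawing

/-! ### Alike vertices -/

namespace SimpleGraph

variable {V : Type*} {G : SimpleGraph V}

/-- The path `s - x - t` of length two. -/
theorem isPath_cons_cons_nil {s x t : V} (h : G.Adj s x) (h' : G.Adj x t) (hst : s ≠ t) :
    (Walk.cons h (Walk.cons h' Walk.nil)).IsPath := by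
  simp [Walk.cons_isPath_iff, h.ne, h'.ne, hst]

theorem PlaneDrawing.not_exists_three_common_neighbors (D : G.PlaneDrawing)
    (hout : ∀ v, D.point v ∈ frontier D.outerFace) {s t : V} (hst : s ≠ t) {x : Fin 3 → V}
    (hx : Function.Injective x) (hs : ∀ i, G.Adj s (x i)) (ht : ∀ i, G.Adj t (x i)) : False := by
  refine D.not_exists_three_paths hout hst
    (fun i ↦ Walk.cons (hs i) (Walk.cons (ht i).symm Walk.nil))
    (fun i ↦ isPath_cons_cons_nil _ _ hst) ?_ ?_
  · intro i
    have := (hs i).ne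
    have := (ht i).ne
    simp only [Walk.edges_cons, Walk.edges_nil, List.mem_cons, Sym2.eq_iff, List.not_mem_nil]
    grind
  · intro i j hij v hvi hvj
    have := hx.ne hij
    simp only [Walk.support_cons, Walk.support_nil, List.mem_cons, List.not_mem_nil] at hvi hvj
    grind

/-- If `a` and `b` are the only neighbours of `u` and of `v` in a biconnected graph, and there is a
fifth vertex `w`, then a path from `a` through the component of `w` to `b` avoids `u`, `v` and the
edge `ab`. -/
theorem IsBiconnected.exists_isPath_avoiding (hbi : G.IsBiconnected) {u v a b w : V}
    (hab : a ≠ b) (hu : ∀ x, G.Adj u x ↔ x = a ∨ x = b) (hv : ∀ x, G.Adj v x ↔ x = a ∨ x = b)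
    (hwu : w ≠ u) (hwv : w ≠ v) (hwa : w ≠ a) (hwb : w ≠ b) :
    ∃ q : G.Walk a b, q.IsPath ∧ u ∉ q.support ∧ v ∉ q.support ∧ s(a, b) ∉ q.edges := by
  classical
  have hua : u ≠ a := ((hu a).2 (.inl rfl)).ne
  have hub : u ≠ b := ((hu b).2 (.inr rfl)).ne
  have hva : v ≠ a := ((hv a).2 (.inl rfl)).ne
  have hvb : v ≠ b := ((hv b).2 (.inr rfl)).ne
  let H : SimpleGraph V := G.deleteEdges {e | u ∈ e ∨ v ∈ e ∨ e = s(a, b)}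
  -- A walk that avoids `d` enters `u` or `v` only from `c`, so it can be stopped at its first visit
  -- to `c`.
  have hreach : ∀ c d : V, s(c, d) = s(a, b) → ∀ x y : ({d}ᶜ : Set V),
      (G.induce {d}ᶜ).Walk x y → (y : V) = c → (x : V) ≠ u → (x : V) ≠ v → H.Reachable x c := by
    intro c d hcd x y p hy
    have hcd' := Sym2.eq_iff.1 hcd
    induction p with
    | nil => intro _ _; rw [hy]
    | @cons x z y h p ih =>
      intro hxu hxv
      have hxd : (x : V) ≠ d := x.2
      have hzd : (z : V) ≠ d := z.2
      by_cases hxc : (x : V) = c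
      · rw [hxc]
      have hadj : G.Adj x z := h
      have hzu : (z : V) ≠ u := by
        intro hz
        have := (hu x).1 (hz ▸ hadj.symm)
        grind
      have hzv : (z : V) ≠ v := by
        intro hz
        have := (hv x).1 (hz ▸ hadj.symm)
        grind
      have hH : H.Adj x z := by
        simp only [H, deleteEdges_adj, mem_ofPred_eq, Sym2.mem_iff, Sym2.eq_iff]
        refine ⟨hadj, ?_⟩
        grind
      exact hH.reachable.trans (ih hy hzu hzv)
  obtain ⟨p⟩ := hbi.2 b ⟨w, hwb⟩ ⟨a, hab⟩
  obtain ⟨p'⟩ := hbi.2 a ⟨w, hwa⟩ ⟨b, hab.symm⟩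
  have hH : H.Reachable a b := (hreach a b rfl _ _ p rfl hwu hwv).symm.trans
    (hreach b a Sym2.eq_swap _ _ p' rfl hwu hwv)
  obtain ⟨q, hq⟩ := hH.exists_isPath
  have hle : H ≤ G := deleteEdges_le _
  have hisol : ∀ x, (∀ z, ¬ H.Adj x z) → ∀ {c d : V} (r : H.Walk c d), x ≠ d →
      x ∉ r.support := by
    intro x hx c d r hxd
    induction r with
    | nil => simpa using hxd
    | @cons c z _ h r ih =>
      rw [Walk.support_cons, List.mem_cons, not_or]
      exact ⟨fun hxc ↦ hx z (hxc ▸ h), ih hxd⟩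
  refine ⟨q.mapLe hle, (Walk.isPath_mapLe hle).2 hq, ?_, ?_, ?_⟩
  · rw [Walk.support_mapLe_eq_support]
    exact hisol u (by simp [H]) q hub
  · rw [Walk.support_mapLe_eq_support]
    exact hisol v (by simp [H]) q hvb
  · rw [Walk.edges_mapLe_eq_edges]
    intro he
    have := q.edges_subset_edgeSet he
    simp [H] at this

theorem PlaneDrawing.not_exists_three_neighbors_of_alike (D : G.PlaneDrawing)
    (hout : ∀ v, D.point v ∈ frontier D.outerFace) {u v : V} (huv : u ≠ v) (hal : G.Alike u v)
    {a b c : V} (hab : a ≠ b) (hac : a ≠ c) (hbc : b ≠ c) (ha : G.Adj u a) (hb : G.Adj u b)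
    (hc : G.Adj u c) : False := by
  have hN : ∀ x, G.Adj u x ↔ G.Adj v x := fun x ↦ Set.ext_iff.1 hal x
  refine D.not_exists_three_common_neighbors hout huv (x := ![a, b, c]) ?_ ?_ ?_
  · intro i j hij
    fin_cases i <;> fin_cases j <;> simp_all
  · intro i; fin_cases i <;> simp [ha, hb, hc]
  · intro i; fin_cases i <;> simp [← hN, ha, hb, hc]

theorem PlaneDrawing.not_exists_alike_of_two_neighbors (D : G.PlaneDrawing)
    (hout : ∀ v, D.point v ∈ frontier D.outerFace) (hbi : G.IsBiconnected) {u v a b w : V}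
    (huv : u ≠ v) (hab : a ≠ b) (hu : ∀ x, G.Adj u x ↔ x = a ∨ x = b)
    (hv : ∀ x, G.Adj v x ↔ x = a ∨ x = b)
    (hwu : w ≠ u) (hwv : w ≠ v) (hwa : w ≠ a) (hwb : w ≠ b) : False := by
  obtain ⟨q, hq, hqu, hqv, hqe⟩ :=
    hbi.exists_isPath_avoiding hab hu hv hwu hwv hwa hwb
  have hau := (hu a).2 (.inl rfl)
  have hub := (hu b).2 (.inr rfl)
  have hav := (hv a).2 (.inl rfl)
  have hvb := (hv b).2 (.inr rfl)
  have hua' := hau.ne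
  have hub' := hub.ne
  have hva' := hav.ne
  have hvb' := hvb.ne
  refine D.not_exists_three_paths hout hab
    ![Walk.cons hau.symm (Walk.cons hub Walk.nil), Walk.cons hav.symm (Walk.cons hvb Walk.nil), q]
    ?_ ?_ ?_
  · intro i
    fin_cases i
    exacts [isPath_cons_cons_nil _ _ hab, isPath_cons_cons_nil _ _ hab, hq]
  · intro i
    fin_cases i
    · simp; grind
    · simp; grind
    · exact hqe
  · intro i j hij x hxi hxj
    fin_cases i <;> fin_cases j <;> simp at hij hxi hxj <;> grind

end SimpleGraph

theorem mainTheorem5 {V : Type*} [Fintype V] (G : SimpleGraph V)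
    (hcard : 5 ≤ Fintype.card V) (houter : G.IsOuterplanar) (hbi : G.IsBiconnected) :
    ¬ ∃ u v : V, u ≠ v ∧ G.Alike u v := by
  classical
  rintro ⟨u, v, huv, hal⟩
  obtain ⟨D, hout⟩ := houter
  have hN : ∀ x, G.Adj u x ↔ G.Adj v x := fun x ↦ Set.ext_iff.1 hal x
  have : Nontrivial V := ⟨u, v, huv⟩
  obtain ⟨a, ha⟩ := hbi.1.preconnected.exists_adj_of_nontrivial u
  have hva := (hN a).1 ha
  -- Since `a` is not a cut vertex, `u` has a second neighbour.
  obtain ⟨b, hb, hba⟩ : ∃ b, G.Adj u b ∧ b ≠ a := by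
    have : Nontrivial ({a}ᶜ : Set V) :=
      ⟨⟨u, ha.ne⟩, ⟨v, hva.ne⟩, fun h ↦ huv (congrArg Subtype.val h)⟩
    obtain ⟨⟨b, hba⟩, hb⟩ := (hbi.2 a).exists_adj_of_nontrivial ⟨u, ha.ne⟩
    exact ⟨b, hb, hba⟩
  by_cases hthree : ∃ c, G.Adj u c ∧ c ≠ a ∧ c ≠ b
  · obtain ⟨c, hc, hca, hcb⟩ := hthree
    exact D.not_exists_three_neighbors_of_alike hout huv hal hba.symm hca.symm hcb.symm ha hb hc
  · push Not at hthree
    have hu : ∀ x, G.Adj u x ↔ x = a ∨ x = b := by grind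
    obtain ⟨w, hw⟩ : ∃ w, w ∉ ({u, v, a, b} : Finset V) := by
      by_contra! h
      have h1 : (Finset.univ : Finset V).card ≤ ({u, v, a, b} : Finset V).card :=
        Finset.card_le_card fun x _ ↦ h x
      have h2 : ({u, v, a, b} : Finset V).card ≤ 4 := Finset.card_le_four
      rw [Finset.card_univ] at h1
      omega
    simp only [Finset.mem_insert, Finset.mem_singleton, not_or] at hw
    exact D.not_exists_alike_of_two_neighbors hout hbi huv hba.symm hu
      (fun x ↦ (hN x).symm.trans (hu x)) hw.1 hw.2.1 hw.2.2.1 hw.2.2.2
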